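/- A $W$-hyperbolic space is a metric space $(X,d)$ with a map $W:X\times X\times[0,1]\to X$, written $W(x,y,t)=(1-t)x+ty$, such that for all $x,y,z,w\in X$ and $s,t\in[0,1]$: $d(z,W(x,y,t))\le(1-t)d(z,x)+t\,d(z,y)$; $d(W(x,y,s),W(x,y,t))=|s-t|\,d(x,y)$; $W(x,y,t)=W(y,x,1-t)$; and $d(W(x,z,t),W(y,w,t))\le(1-t)d(x,y)+t\,d(z,w)$. A CAT(0) space is a $W$-hyperbolic space with $d^2(z,W(x,y,\tfrac12))\le\tfrac12d^2(z,x)+\tfrac12d^2(z,y)-\tfrac14d^2(x,y)$ for all $x,y,z\in X$. Let $X$ be a complete CAT(0) space and $C\subseteq X$ a nonempty closed set which is convex, i.e. $W(x,y,t)\in C$ for all $x,y\in C$, $t\in[0,1]$. Let $(T_n)_{n\in\mathbb N}$ be a sequence of nonexpansive maps $T_n:C\to C$ with a common fixed point, let $f:C\to C$ be an $\alpha$-contraction with $\alpha\in[0,1)$, and let $(\alpha_n)\subseteq(0,1]$ and $(\lambda_n)\subseteq(0,\infty)$. Assume that $$d(T_ny,T_my)\le\left|1-\frac{\lambda_m}{\lambda_n}\right|d(y,T_ny)\qquad\text{for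 all } m,n\in\mathbb N,\ y\in C,$$ and that $$\sum_{n=0}^\infty\alpha_n=\infty,\qquad \lim_{n\to\infty}\alpha_n=0,\qquad \lim_{n\to\infty}\frac{|\alpha_{n+1}-\alpha_n|}{\alpha_n^2}=0,\qquad \lim_{n\to\infty}\lambda_n=\lambda>0.$$ For $x\in C$ let $w_0(x)=x$ and $w_{n+1}(x)=\alpha_nx+(1-\alpha_n)T_nw_n(x)$. Then for every $x\in C$ the limit $Q(x)=\lim_{n\to\infty}w_n(x)\in C$ exists, the map $Q\circ f:C\to C$ has a unique fixed point, and for every $x_0\in C$ the iteration $x_{n+1}=\alpha_nf(x_n)+(1-\alpha_n)T_nx_n$ converges strongly (i.e. in the metric $d$) to this fixed point. -/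

import Mathlib

/-- A `W`-space: a type with a convexity mapping `W : X × X × [0,1] → X`
(the metric is carried separately). The point `W x y t` is written `(1 - t) x + t y`. -/
class WSpace (X : Type*) where
  W : X → X → unitInterval → X

/-- A `W`-hyperbolic space. -/
class WHyperbolicSpace (X : Type*) [MetricSpace X] [WSpace X] : Prop where
  dist_W_le : ∀ (x y z : X) (t : unitInterval),
    dist z (WSpace.W x y t) ≤ (1 - (t : ℝ)) * dist z x + (t : ℝ) * dist z y
  dist_W_W : ∀ (x y : X) (s t : unitInterval),
    dist (WSpace.W x y s) (WSpace.W x y t) = |(s : ℝ) - (t : ℝ)| * dist x y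
  W_symm : ∀ (x y : X) (t : unitInterval),
    WSpace.W x y t = WSpace.W y x (unitInterval.symm t)
  dist_W_W_le : ∀ (x y z w : X) (t : unitInterval),
    dist (WSpace.W x z t) (WSpace.W y w t) ≤ (1 - (t : ℝ)) * dist x y + (t : ℝ) * dist z w

/-- A CAT(0) space: a `W`-hyperbolic space in which the midpoints `W x y (1/2)` satisfy the
Bruhat–Tits (CN) inequality. -/
class CAT0Space (X : Type*) [MetricSpace X] [WSpace X] : Prop extends WHyperbolicSpace X where
  dist_midpoint_sq_le : ∀ (x y z : X) (t : unitInterval), (t : ℝ) = 1 / 2 →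
    dist z (WSpace.W x y t) ^ 2
      ≤ 1 / 2 * dist z x ^ 2 + 1 / 2 * dist z y ^ 2 - 1 / 4 * dist x y ^ 2

/-- Convex subsets of a `W`-space (nonempty by definition). -/
structure IsWConvex {X : Type*} [WSpace X] (C : Set X) : Prop where
  nonempty : C.Nonempty
  W_mem : ∀ x ∈ C, ∀ y ∈ C, ∀ t : unitInterval, WSpace.W x y t ∈ C

/-- For a convex set `C` and `x y : C`, the point `t x + (1 - t) y = W x y (1 - t)` of `C`. -/
def IsWConvex.comb {X : Type*} [WSpace X] {C : Set X} (hC : IsWConvex C)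
    (t : unitInterval) (x y : C) : C :=
  ⟨WSpace.W (x : X) (y : X) (unitInterval.symm t), hC.W_mem x x.2 y y.2 (unitInterval.symm t)⟩

/-- The generalized viscosity approximation method
`x_{n+1} = α_n f(x_n) + (1 - α_n) T_n x_n`, started at `x₀`. -/
def genVAM {X : Type*} [WSpace X] {C : Set X} (hC : IsWConvex C) (α : ℕ → unitInterval)
    (f : C → C) (T : ℕ → C → C) (x₀ : C) : ℕ → C
  | 0 => x₀
  | n + 1 => hC.comb (α n) (f (genVAM hC α f T x₀ n)) (T n (genVAM hC α f T x₀ n))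

/-- The abstract Halpern-type proximal point algorithm with anchor `u`,
`x*_{n+1} = α_n u + (1 - α_n) T_n x*_n`, started at `x₀`. -/
def abstractHPPA {X : Type*} [WSpace X] {C : Set X} (hC : IsWConvex C) (α : ℕ → unitInterval)
    (T : ℕ → C → C) (u x₀ : C) : ℕ → C
  | 0 => x₀
  | n + 1 => hC.comb (α n) u (T n (abstractHPPA hC α T u x₀ n))

/-- The condition `Res((lam_n), n, m)` for the family `(T_n)`. -/
def ResolventLike {X : Type*} [MetricSpace X] {C : Set X} (T : ℕ → C → C) (lam : ℕ → ℝ)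
    (n m : ℕ) : Prop :=
  ∀ y : C, dist (T n y) (T m y) ≤ |1 - lam m / lam n| * dist y (T n y)

/-!
Write `T y = lim T_n y`; the limit exists because `d(T_n y, T_m y) ≤ |1 - λ_m / λ_n| d(y, T_n y)`
and `λ_n → λ > 0`, and it satisfies `d(T y, T_m y) ≤ |1 - λ_m / λ| d(y, T y)`
(`exists_resolvent_limit`).

For an anchor `u` let `z_n` be the fixed point of the contraction `x ↦ α_n u + (1 - α_n) T x`.
In a CAT(0) space two such fixed points with parameters `s ≤ t` satisfy
`d(z_t, z_s)² ≤ d(z_s, u)² - d(z_t, u)²` (`dist_sq_le_of_browder`), so `z_n` converges as soon as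
`α_n → 0`, without any monotonicity of `α_n` (`cauchySeq_of_dist_sq_le`).

The Halpern iteration `w_n` anchored at `u` tracks `z_n`: both the error `d(T_n z_n, T z_n)`, which
is at most `|1 - λ_n / λ| d(z_n, T z_n) = |1 - λ_n / λ| α_n d(u, T z_n)`, and the drift
`d(z_n, z_{n+1})`, which is `O(|α_{n+1} - α_n| / α_n)`, are `o(α_n)`. Since `∑ α_n = ∞`, the
standard lemma on recursive inequalities (`tendsto_zero_of_le_one_sub_mul_add`) gives
`d(w_n, z_n) → 0` (`exists_tendsto_halpern`).

The limit `Q u` is nonexpansive in `u`, so `Q ∘ f` is a contraction of a complete space. If `p` is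
its fixed point, then the viscosity iteration is compared with the Halpern iteration anchored at
`f p`, which converges to `p`; the same recursive inequality, now with step `(1 - κ) α_n`, shows
that their distance tends to `0`.
-/

open Filter Topology

/-! ### Recursive inequalities for real sequences -/

/-- If `a (n + 1) ≤ (1 - γ n) a n + γ n b n` with `b → 0` and `∑ γ n = ∞`, then `a → 0`. -/
theorem tendsto_zero_of_le_one_sub_mul_add {a γ b : ℕ → ℝ} (ha : ∀ n, 0 ≤ a n)
    (hγ1 : ∀ n, γ n ≤ 1)
    (hsum : Tendsto (fun N => ∑ n ∈ Finset.range N, γ n) atTop atTop)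
    (hb : Tendsto b atTop (𝓝 0)) (hγ0 : ∀ n, 0 ≤ γ n)
    (h : ∀ n, a (n + 1) ≤ (1 - γ n) * a n + γ n * b n) :
    Tendsto a atTop (𝓝 0) := by
  refine Metric.tendsto_atTop.2 fun ε hε => ?_
  obtain ⟨N, hN⟩ := eventually_atTop.1 (hb.eventually_le_const (half_pos hε))
  let s : ℕ → ℝ := fun n => ∑ i ∈ Finset.range n, γ i
  -- Past `N` the excess of `a` over `ε / 2` decays like `∏ (1 - γ i) ≤ exp (-∑ γ i)`.
  have key : ∀ n, N ≤ n → a n - ε / 2 ≤ Real.exp (s N - s n) * a N := by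
    intro n hn
    induction n, hn using Nat.le_induction with
    | base => simp only [sub_self, Real.exp_zero, one_mul]; linarith
    | succ n hn ih =>
      have h1 : 1 - γ n ≤ Real.exp (-γ n) := by linarith [Real.add_one_le_exp (-γ n)]
      have h2 : Real.exp (s N - s (n + 1)) = Real.exp (-γ n) * Real.exp (s N - s n) := by
        rw [← Real.exp_add]
        congr 1
        simp only [s, Finset.sum_range_succ]
        ring
      calc a (n + 1) - ε / 2 ≤ (1 - γ n) * (a n - ε / 2) := by
            nlinarith [h n, mul_le_mul_of_nonneg_left (hN n hn) (hγ0 n)]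
        _ ≤ (1 - γ n) * (Real.exp (s N - s n) * a N) :=
            mul_le_mul_of_nonneg_left ih (by linarith [hγ1 n])
        _ ≤ Real.exp (-γ n) * (Real.exp (s N - s n) * a N) :=
            mul_le_mul_of_nonneg_right h1 (mul_nonneg (Real.exp_pos _).le (ha N))
        _ = Real.exp (s N - s (n + 1)) * a N := by rw [h2]; ring
  have hlim : Tendsto (fun n => Real.exp (s N - s n) * a N) atTop (𝓝 0) := by
    have h1 : Tendsto (fun n => s N - s n) atTop atBot :=
      tendsto_atBot_add_const_left _ _ (tendsto_neg_atTop_atBot.comp hsum)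
    simpa using (Real.tendsto_exp_atBot.comp h1).mul_const (a N)
  obtain ⟨M, hM⟩ := eventually_atTop.1 (hlim.eventually_lt_const (half_pos hε))
  refine ⟨max N M, fun n hn => ?_⟩
  rw [Real.dist_0_eq_abs, abs_of_nonneg (ha n)]
  linarith [key n (le_trans (le_max_left _ _) hn), hM n (le_trans (le_max_right _ _) hn)]

/-- A sequence indexed by parameters `t n → 0` whose squared distances are bounded by the increments
of a bounded function `h`, which increases as the parameter decreases, is Cauchy. -/
theorem cauchySeq_of_dist_sq_le {Y : Type*} [PseudoMetricSpace Y] {z : ℕ → Y} {t h : ℕ → ℝ}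
    (ht : ∀ n, 0 < t n) (htlim : Tendsto t atTop (𝓝 0)) (hbdd : BddAbove (Set.range h))
    (hz : ∀ n m, t m ≤ t n → dist (z n) (z m) ^ 2 ≤ h m - h n) : CauchySeq z := by
  refine Metric.cauchySeq_iff.2 fun ε hε => ?_
  -- `z N` is a centre: `h N` nearly attains the supremum, and all late parameters are below `t N`.
  obtain ⟨_, ⟨N, rfl⟩, hN⟩ := exists_lt_of_lt_csSup (Set.range_nonempty h)
    (show sSup (Set.range h) - (ε / 2) ^ 2 < sSup (Set.range h) by
      linarith [pow_pos (half_pos hε) 2])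
  obtain ⟨M, hM⟩ := eventually_atTop.1 (htlim.eventually_le_const (ht N))
  have key : ∀ n, M ≤ n → dist (z N) (z n) < ε / 2 := by
    intro n hn
    refine lt_of_pow_lt_pow_left₀ 2 (half_pos hε).le ?_
    linarith [hz N n (hM n hn), le_csSup hbdd (Set.mem_range_self n)]
  refine ⟨M, fun m hm n hn => ?_⟩
  linarith [key m hm, key n hn, dist_triangle_left (z m) (z n) (z N)]

/-- At a positive maximum of `h`, reflecting the nearer endpoint through the maximum point
contradicts midpoint convexity. -/
theorem nonpos_of_midpoint_convex {h : ℝ → ℝ} {s r : ℝ} (hc : ContinuousOn h (Set.Icc 0 s))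
    (h0 : h 0 ≤ 0) (hs : h s ≤ 0)
    (hm : ∀ a ∈ Set.Icc 0 s, ∀ b ∈ Set.Icc 0 s, h ((a + b) / 2) ≤ (h a + h b) / 2)
    (hr : r ∈ Set.Icc 0 s) : h r ≤ 0 := by
  obtain ⟨c, hcs, hmax⟩ := isCompact_Icc.exists_isMaxOn ⟨r, hr⟩ hc
  refine (hmax hr).trans ?_
  rcases le_total c (s - c) with hle | hle
  · have h1 : 2 * c ∈ Set.Icc 0 s := ⟨by linarith [hcs.1], by linarith⟩
    have h2 := hm 0 ⟨le_rfl, hcs.1.trans hcs.2⟩ (2 * c) h1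
    have h3 : h (2 * c) ≤ h c := hmax h1
    rw [show (0 + 2 * c) / 2 = c by ring] at h2
    linarith
  · have h1 : 2 * c - s ∈ Set.Icc 0 s := ⟨by linarith, by linarith [hcs.2]⟩
    have h2 := hm (2 * c - s) h1 s ⟨hcs.1.trans hcs.2, le_rfl⟩
    have h3 : h (2 * c - s) ≤ h c := hmax h1
    rw [show (2 * c - s + s) / 2 = c by ring] at h2
    linarith

/-! ### Geometry of CAT(0) spaces -/

section Geometry

variable {Y : Type*} [MetricSpace Y] [WSpace Y]

theorem WHyperbolicSpace.W_zero [WHyperbolicSpace Y] (x y : Y) : WSpace.W x y 0 = x := by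
  have h := dist_W_le x y x 0
  simp only [Set.Icc.coe_zero, dist_self, mul_zero, zero_mul, add_zero] at h
  exact (dist_le_zero.1 h).symm

/-- Sliding the parameter and the endpoint of a geodesic starting at `u`. -/
theorem WHyperbolicSpace.dist_W_W_add_le [WHyperbolicSpace Y] (u x y : Y) (s t : unitInterval) :
    dist (WSpace.W u x s) (WSpace.W u y t) ≤ s * dist x y + |(s : ℝ) - t| * dist u y := by
  have h := dist_W_W_le u u x y s
  rw [dist_self, mul_zero, zero_add] at h
  exact (dist_triangle _ (WSpace.W u y s) _).trans (add_le_add h (dist_W_W u y s t).le)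

/-- The CN inequality at any metric midpoint of `x` and `y`. -/
theorem CAT0Space.dist_sq_le_of_midpoint [CAT0Space Y] {x y m : Y} (hx : dist m x = dist x y / 2)
    (hy : dist m y = dist x y / 2) (z : Y) :
    dist z m ^ 2 ≤ 1 / 2 * dist z x ^ 2 + 1 / 2 * dist z y ^ 2 - 1 / 4 * dist x y ^ 2 := by
  let t : unitInterval := ⟨1 / 2, by norm_num, by norm_num⟩
  -- The CN inequality, tested at `m` itself, shows that `m` is the midpoint given by `W`.
  have h := dist_midpoint_sq_le x y m t rfl
  rw [hx, hy] at h
  have h0 : dist m (WSpace.W x y t) = 0 := by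
    refine pow_eq_zero_iff two_ne_zero |>.1 (le_antisymm ?_ (sq_nonneg _))
    linarith
  rw [dist_eq_zero.1 h0]
  exact dist_midpoint_sq_le x y z t rfl

/-- The CAT(0) inequality for the point `W x y r` of the geodesic from `x` to `W x y s`. -/
theorem CAT0Space.mul_dist_W_sq_le [CAT0Space Y] (x y z : Y) {r s : unitInterval} (hrs : r ≤ s) :
    s * dist z (WSpace.W x y r) ^ 2 ≤ (s - r) * dist z x ^ 2 + r * dist z (WSpace.W x y s) ^ 2
      - r * (s - r) * s * dist x y ^ 2 := by
  let γ : ℝ → Y := fun τ => WSpace.W x y (Set.projIcc 0 1 zero_le_one τ)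
  have hγ (τ : unitInterval) : γ τ = WSpace.W x y τ := by
    simp only [γ]
    rw [Set.projIcc_val]
  have hdist : ∀ a ∈ Set.Icc (0 : ℝ) 1, ∀ b ∈ Set.Icc (0 : ℝ) 1,
      dist (γ a) (γ b) = |a - b| * dist x y := by
    intro a ha b hb
    have h1 := hγ ⟨a, ha⟩
    have h2 := hγ ⟨b, hb⟩
    simp only at h1 h2
    rw [h1, h2]
    exact WHyperbolicSpace.dist_W_W x y ⟨a, ha⟩ ⟨b, hb⟩
  have hsub : Set.Icc (0 : ℝ) s ⊆ Set.Icc 0 1 := Set.Icc_subset_Icc_right s.2.2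
  have hcont : ContinuousOn γ (Set.Icc 0 s) := by
    refine LipschitzOnWith.continuousOn (K := (dist x y).toNNReal) <|
      LipschitzOnWith.of_dist_le_mul fun a ha b hb => ?_
    rw [hdist a (hsub ha) b (hsub hb), Real.dist_eq, Real.coe_toNNReal _ dist_nonneg, mul_comm]
  have hγ0 : γ 0 = x := by
    rw [← WHyperbolicSpace.W_zero x y]
    exact hγ 0
  -- Subtracting `τ ^ 2 * dist x y ^ 2` from the squared distance to `γ τ` leaves a midpoint convex
  -- function of `τ`; `h` compares it with its chord over `[0, s]`.
  let h : ℝ → ℝ := fun τ => s * (dist z (γ τ) ^ 2 - τ ^ 2 * dist x y ^ 2)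
    - (s - τ) * dist z x ^ 2 - τ * (dist z (γ s) ^ 2 - s ^ 2 * dist x y ^ 2)
  have key : h r ≤ 0 := by
    refine nonpos_of_midpoint_convex (s := s) ?_ ?_ ?_ ?_ ⟨r.2.1, hrs⟩
    · have : ContinuousOn (fun τ => dist z (γ τ)) (Set.Icc 0 (s : ℝ)) :=
        (continuous_const.dist continuous_id).comp_continuousOn hcont
      fun_prop
    · simp only [h, hγ0]
      apply le_of_eq
      ring
    · simp only [h]
      apply le_of_eq
      ring
    · intro a ha b hb
      have hmid : (a + b) / 2 ∈ Set.Icc (0 : ℝ) 1 :=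
        hsub ⟨by linarith [ha.1, hb.1], by linarith [ha.2, hb.2]⟩
      have hab := hdist a (hsub ha) b (hsub hb)
      have h1 := CAT0Space.dist_sq_le_of_midpoint (x := γ a) (y := γ b) (m := γ ((a + b) / 2))
        (by
          rw [hdist _ hmid a (hsub ha), hab, show (a + b) / 2 - a = -((a - b) / 2) by ring, abs_neg,
            abs_div, abs_two]
          ring)
        (by
          rw [hdist _ hmid b (hsub hb), hab, show (a + b) / 2 - b = (a - b) / 2 by ring,
            abs_div, abs_two]
          ring) z
      rw [hab, mul_pow, sq_abs] at h1
      have h2 := mul_le_mul_of_nonneg_left h1 s.2.1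
      simp only [h]
      linarith
  simp only [h, hγ] at key
  linarith

end Geometry

/-! ### Fixed points of the averaged maps -/

section Browder

variable {Y : Type*} [MetricSpace Y] [WSpace Y]

open WSpace WHyperbolicSpace unitInterval

theorem exists_eq_W_symm [WHyperbolicSpace Y] [CompleteSpace Y] {T : Y → Y}
    (hT : LipschitzWith 1 T) (u : Y) {t : unitInterval} (ht : 0 < (t : ℝ)) :
    ∃ z, z = W u (T z) (σ t) := by
  have : Nonempty Y := ⟨u⟩
  have hc : ContractingWith (Real.toNNReal (σ t)) (fun x => W u (T x) (σ t)) := by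
    refine ⟨?_, LipschitzWith.of_dist_le_mul fun x y => ?_⟩
    · rw [Real.toNNReal_lt_one, coe_symm_eq]
      linarith
    · rw [Real.coe_toNNReal _ (σ t).2.1]
      have h := dist_W_W_add_le u (T x) (T y) (σ t) (σ t)
      rw [sub_self, abs_zero, zero_mul, add_zero] at h
      exact h.trans (mul_le_mul_of_nonneg_left (hT.dist_le_mul_of_le le_rfl |>.trans (by simp))
        (σ t).2.1)
  exact ⟨_, hc.fixedPoint_isFixedPt.symm⟩

/-- Fixed points `z`, `w` of the averaged maps with parameters `s ≤ t`: the squared distance between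
them is at most the gap between their squared distances to the anchor. -/
theorem dist_sq_le_of_browder [CAT0Space Y] {T : Y → Y} (hT : LipschitzWith 1 T) {u z w : Y}
    {s t : unitInterval} (hs : 0 < (s : ℝ)) (hst : s ≤ t) (hz : z = W u (T z) (σ t))
    (hw : w = W u (T w) (σ s)) : dist z w ^ 2 ≤ dist w u ^ 2 - dist z u ^ 2 := by
  have hst' : (s : ℝ) ≤ t := hst
  -- Compare `w` with the point of parameter `s` on the geodesic from `u` through `z` to `T z`.
  have hc : dist w (W u (T z) (σ s)) ≤ dist z w := by
    have h := dist_W_W_add_le u (T w) (T z) (σ s) (σ s)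
    rw [← hw, sub_self, abs_zero, zero_mul, add_zero] at h
    have h1 : dist (T w) (T z) ≤ dist w z := by simpa using hT.dist_le_mul w z
    rw [dist_comm z w]
    refine h.trans (le_trans (mul_le_mul_of_nonneg_left h1 (σ s).2.1) ?_)
    exact mul_le_of_le_one_left dist_nonneg (σ s).2.2
  have hzu : dist z u = (1 - t) * dist u (T z) := by
    have h := dist_W_W u (T z) (σ t) 0
    rw [W_zero, ← hz] at h
    rw [h, Set.Icc.coe_zero, sub_zero, coe_symm_eq, abs_of_nonneg (by linarith [t.2.2])]
  rcases hst'.eq_or_lt with heq | hlt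
  · obtain rfl : s = t := Subtype.ext heq
    -- Equal parameters give equal fixed points, by uniqueness for the contraction.
    have h0 : dist z w = 0 := by
      have h := dist_W_W_add_le u (T z) (T w) (σ s) (σ s)
      rw [← hw, ← hz, sub_self, abs_zero, zero_mul, add_zero, coe_symm_eq] at h
      have h1 : dist (T z) (T w) ≤ dist z w := by simpa using hT.dist_le_mul z w
      have h2 := mul_le_mul_of_nonneg_left h1 (sub_nonneg.2 s.2.2)
      refine le_antisymm ?_ dist_nonneg
      nlinarith
    rw [dist_eq_zero.1 h0]
    simp
  · have h := CAT0Space.mul_dist_W_sq_le u (T z) w (symm_le_symm.2 hst)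
    rw [← hz] at h
    simp only [coe_symm_eq] at h
    have h1 := pow_le_pow_left₀ dist_nonneg hc 2
    have h2 := mul_le_mul_of_nonneg_left h1 (sub_nonneg.2 t.2.2)
    rw [dist_comm w z] at h
    rw [hzu]
    set D := dist u (T z)
    have h3 : (t - s : ℝ) * dist z w ^ 2
        ≤ (t - s) * (dist w u ^ 2 - (1 - t) * (1 - s) * D ^ 2) := by linarith
    have h4 := le_of_mul_le_mul_left h3 (sub_pos.2 hlt)
    have h5 : (1 - t : ℝ) * (1 - t) * D ^ 2 ≤ (1 - t) * (1 - s) * D ^ 2 :=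
      mul_le_mul_of_nonneg_right
        (mul_le_mul_of_nonneg_left (by linarith) (sub_nonneg.2 t.2.2)) (sq_nonneg D)
    linarith

/-- The fixed point of an averaged map is no farther from a fixed point of `T` than the anchor. -/
theorem dist_le_of_browder [WHyperbolicSpace Y] {T : Y → Y} (hT : LipschitzWith 1 T) {u z p : Y}
    (hp : T p = p) {t : unitInterval} (ht : 0 < (t : ℝ)) (hz : z = W u (T z) (σ t)) :
    dist p (T z) ≤ dist p u ∧ dist p z ≤ dist p u := by
  have h := dist_W_le u (T z) p (σ t)
  rw [← hz, coe_symm_eq] at h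
  have h1 : dist p (T z) ≤ dist p z := by simpa [hp] using hT.dist_le_mul p z
  have h2 := mul_le_mul_of_nonneg_left h1 (sub_nonneg.2 t.2.2)
  have h3 : dist p z ≤ dist p u := le_of_mul_le_mul_left (by linarith) ht
  exact ⟨h1.trans h3, h3⟩

/-- The fixed points of the averaged maps converge when the parameters tend to `0`. -/
theorem exists_tendsto_browder [CAT0Space Y] [CompleteSpace Y] {T : Y → Y}
    (hT : LipschitzWith 1 T) {u p : Y} (hp : T p = p) {α : ℕ → unitInterval}
    (hα : ∀ n, 0 < (α n : ℝ)) (hαlim : Tendsto (fun n => (α n : ℝ)) atTop (𝓝 0)) {z : ℕ → Y}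
    (hz : ∀ n, z n = W u (T (z n)) (σ (α n))) : ∃ q, Tendsto z atTop (𝓝 q) := by
  refine cauchySeq_tendsto_of_complete
    (cauchySeq_of_dist_sq_le (h := fun n => dist (z n) u ^ 2) hα hαlim ?_ fun n m hmn =>
      dist_sq_le_of_browder hT (hα m) hmn (hz n) (hz m))
  refine ⟨(dist p u + dist p u) ^ 2, ?_⟩
  rintro _ ⟨n, rfl⟩
  refine pow_le_pow_left₀ dist_nonneg ?_ 2
  linarith [dist_triangle_left (z n) u p, (dist_le_of_browder hT hp (hα n) (hz n)).2]

/-! ### Limits of resolvent-like families and Halpern iterations -/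

/-- A family of nonexpansive maps satisfying the resolvent condition with convergent parameters has
a pointwise limit `S`. The bound carries the displacement of `S` rather than that of `T m`, which is
`O(t)` at the fixed point of the averaged map of `S` with parameter `t`. -/
theorem exists_resolvent_limit {Z : Type*} [MetricSpace Z] [CompleteSpace Z]
    {T : ℕ → Z → Z} (hT : ∀ n, LipschitzWith 1 (T n)) {p : Z} (hp : ∀ n, T n p = p)
    {lam : ℕ → ℝ} {l : ℝ} (hl : 0 < l) (hlam : Tendsto lam atTop (𝓝 l))
    (hRes : ∀ n m y, dist (T n y) (T m y) ≤ |1 - lam m / lam n| * dist y (T n y)) :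
    ∃ S : Z → Z, LipschitzWith 1 S ∧ S p = p ∧
      ∀ m y, dist (S y) (T m y) ≤ |1 - lam m / l| * dist y (S y) := by
  have hcau (y : Z) : ∃ q, Tendsto (fun n => T n y) atTop (𝓝 q) := by
    refine cauchySeq_tendsto_of_complete ?_
    have hbd (n : ℕ) : dist y (T n y) ≤ 2 * dist y p := by
      have h1 : dist (T n y) p ≤ dist y p := by simpa [hp n] using (hT n).dist_le_mul y p
      linarith [dist_triangle_right y (T n y) p]
    refine Metric.cauchySeq_iff.2 fun ε hε => ?_
    have hlim : Tendsto (fun q : ℕ × ℕ => |1 - lam q.2 / lam q.1| * (2 * dist y p))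
        (atTop ×ˢ atTop) (𝓝 0) := by
      have h := ((((hlam.comp tendsto_snd).div (hlam.comp tendsto_fst) hl.ne').const_sub
        1).abs).mul_const (2 * dist y p)
      rw [div_self hl.ne', sub_self, abs_zero, zero_mul] at h
      exact h
    rw [prod_atTop_atTop_eq] at hlim
    obtain ⟨N, hN⟩ := eventually_atTop.1 (hlim.eventually_lt_const hε)
    refine ⟨max N.1 N.2, fun m hm n hn => ?_⟩
    exact (hRes m n y).trans_lt ((mul_le_mul_of_nonneg_left (hbd m) (abs_nonneg _)).trans_lt
      (hN (m, n) ⟨(le_max_left _ _).trans hm, (le_max_right _ _).trans hn⟩))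
  choose S hS using hcau
  refine ⟨S, LipschitzWith.of_dist_le_mul fun x y => ?_, ?_, fun m y => ?_⟩
  · exact le_of_tendsto' ((hS x).dist (hS y)) fun n => (hT n).dist_le_mul x y
  · refine tendsto_nhds_unique (hS p) ?_
    simp only [hp]
    exact tendsto_const_nhds
  · refine le_of_tendsto_of_tendsto' ((hS y).dist tendsto_const_nhds)
      (((((tendsto_const_nhds (x := lam m)).div hlam hl.ne').const_sub 1).abs).mul
        (tendsto_const_nhds.dist (hS y))) fun n => hRes n m y

/-- The limit depends only on the anchor `u`, not on the starting point of the iteration. -/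
theorem exists_tendsto_halpern [CAT0Space Y] [CompleteSpace Y] {T : ℕ → Y → Y}
    (hT : ∀ n, LipschitzWith 1 (T n)) {p : Y} (hp : ∀ n, T n p = p) {lam : ℕ → ℝ} {l : ℝ}
    (hl : 0 < l) (hlam : Tendsto lam atTop (𝓝 l))
    (hRes : ∀ n m y, dist (T n y) (T m y) ≤ |1 - lam m / lam n| * dist y (T n y))
    {α : ℕ → unitInterval} (hα : ∀ n, 0 < (α n : ℝ))
    (hαsum : Tendsto (fun N => ∑ n ∈ Finset.range N, (α n : ℝ)) atTop atTop)
    (hαlim : Tendsto (fun n => (α n : ℝ)) atTop (𝓝 0))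
    (hαdiff : Tendsto (fun n => |(α (n + 1) : ℝ) - (α n : ℝ)| / (α n : ℝ) ^ 2) atTop (𝓝 0))
    (u : Y) : ∃ q, ∀ w : ℕ → Y, (∀ n, w (n + 1) = W u (T n (w n)) (σ (α n))) →
      Tendsto w atTop (𝓝 q) := by
  obtain ⟨S, hS, hSp, hST⟩ := exists_resolvent_limit hT hp hl hlam hRes
  choose z hz using fun n => exists_eq_W_symm hS u (hα n)
  obtain ⟨q, hq⟩ := exists_tendsto_browder hS hSp hα hαlim hz
  refine ⟨q, fun w hw => ?_⟩
  set M := 2 * dist p u with hM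
  have hSz (n : ℕ) : dist u (S (z n)) ≤ M := by
    linarith [dist_triangle_left u (S (z n)) p, (dist_le_of_browder hS hSp (hα n) (hz n)).1]
  have hα1 (n : ℕ) : 0 ≤ 1 - (α n : ℝ) := sub_nonneg.2 (α n).2.2
  -- The drift of the fixed points: subtracting `(1 - α n) * dist (z n) (z (n + 1))` from both sides
  -- leaves `α n` times the drift on the left, hence the division by `α n ^ 2` in the hypothesis.
  have hdrift (n : ℕ) : dist (z n) (z (n + 1))
      ≤ α n * (M * (|(α (n + 1) : ℝ) - (α n : ℝ)| / (α n : ℝ) ^ 2)) := by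
    have h := dist_W_W_add_le u (S (z n)) (S (z (n + 1))) (σ (α n)) (σ (α (n + 1)))
    rw [← hz, ← hz, coe_symm_eq, coe_symm_eq,
      show (1 - α n - (1 - α (n + 1)) : ℝ) = α (n + 1) - α n by ring] at h
    have h1 : dist (S (z n)) (S (z (n + 1))) ≤ dist (z n) (z (n + 1)) := by
      simpa using hS.dist_le_mul (z n) (z (n + 1))
    have h2 := mul_le_mul_of_nonneg_left h1 (hα1 n)
    have h3 := mul_le_mul_of_nonneg_left (hSz (n + 1)) (abs_nonneg ((α (n + 1) : ℝ) - α n))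
    have h4 : (α n : ℝ) * (M * (|(α (n + 1) : ℝ) - (α n : ℝ)| / (α n : ℝ) ^ 2))
        = |(α (n + 1) : ℝ) - α n| * M / α n := by
      have := (hα n).ne'
      field_simp
    rw [h4, le_div_iff₀ (hα n)]
    linarith
  have herr (n : ℕ) : dist (T n (z n)) (S (z n)) ≤ |1 - lam n / l| * (α n * M) := by
    rw [dist_comm]
    refine (hST n (z n)).trans (mul_le_mul_of_nonneg_left ?_ (abs_nonneg _))
    have h := dist_W_le u (S (z n)) (S (z n)) (σ (α n))
    rw [← hz, dist_self, mul_zero, add_zero, coe_symm_eq, sub_sub_cancel, dist_comm _ u,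
      dist_comm _ (z n)] at h
    exact h.trans (mul_le_mul_of_nonneg_left (hSz n) (hα n).le)
  have hlim : Tendsto (fun n => dist (w n) (z n)) atTop (𝓝 0) := by
    refine tendsto_zero_of_le_one_sub_mul_add (γ := fun n => α n)
      (b := fun n => |1 - lam n / l| * M + M * (|(α (n + 1) : ℝ) - (α n : ℝ)| / (α n : ℝ) ^ 2))
      (fun n => dist_nonneg) (fun n => (α n).2.2) hαsum ?_ (fun n => (hα n).le) fun n => ?_
    · have h := (((hlam.div_const l).const_sub 1).abs.mul_const M).add (hαdiff.const_mul M)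
      rw [div_self hl.ne', sub_self, abs_zero, zero_mul, mul_zero, add_zero] at h
      exact h
    · have h := dist_W_W_add_le u (T n (w n)) (S (z n)) (σ (α n)) (σ (α n))
      rw [← hz, ← hw, sub_self, abs_zero, zero_mul, add_zero, coe_symm_eq] at h
      have h1 : dist (T n (w n)) (T n (z n)) ≤ dist (w n) (z n) := by
        simpa using (hT n).dist_le_mul (w n) (z n)
      have h2 := dist_triangle (T n (w n)) (T n (z n)) (S (z n))
      have h3 : (1 - α n : ℝ) * dist (T n (w n)) (S (z n))
          ≤ (1 - α n) * (dist (w n) (z n)) + |1 - lam n / l| * (α n * M) := by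
        refine (mul_le_mul_of_nonneg_left (h2.trans (add_le_add h1 le_rfl)) (hα1 n)).trans ?_
        rw [mul_add]
        refine add_le_add le_rfl ((mul_le_of_le_one_left dist_nonneg ?_).trans (herr n))
        linarith [hα n]
      linarith [dist_triangle (w (n + 1)) (z n) (z (n + 1)), hdrift n]
  refine (tendsto_iff_dist_tendsto_zero).2 ?_
  refine squeeze_zero (fun n => dist_nonneg) (fun n => dist_triangle (w n) (z n) q) ?_
  simpa using hlim.add (tendsto_iff_dist_tendsto_zero.1 hq)

/-! ### The viscosity iteration -/

/-- Halpern iterations started at their anchors never move farther apart than the anchors. This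
makes the limit nonexpansive in the anchor. -/
theorem dist_halpern_le [WHyperbolicSpace Y] {T : ℕ → Y → Y} (hT : ∀ n, LipschitzWith 1 (T n))
    {α : ℕ → unitInterval} {u v : Y} {w w' : ℕ → Y} (h0 : w 0 = u) (h0' : w' 0 = v)
    (hw : ∀ n, w (n + 1) = W u (T n (w n)) (σ (α n)))
    (hw' : ∀ n, w' (n + 1) = W v (T n (w' n)) (σ (α n))) (n : ℕ) :
    dist (w n) (w' n) ≤ dist u v := by
  induction n with
  | zero => rw [h0, h0']
  | succ n ih =>
    have h := dist_W_W_le u v (T n (w n)) (T n (w' n)) (σ (α n))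
    have h1 : dist (T n (w n)) (T n (w' n)) ≤ dist (w n) (w' n) := by
      simpa using (hT n).dist_le_mul (w n) (w' n)
    have h2 := mul_le_mul_of_nonneg_left (h1.trans ih) (σ (α n)).2.1
    rw [hw, hw']
    linarith

/-- If the Halpern iteration anchored at `f p` converges to `p`, then so does every viscosity
iteration with the contraction `f`. -/
theorem tendsto_viscosity [WHyperbolicSpace Y] {T : ℕ → Y → Y} (hT : ∀ n, LipschitzWith 1 (T n))
    {f : Y → Y} {κ : NNReal} (hf : ContractingWith κ f) {α : ℕ → unitInterval}
    (hαsum : Tendsto (fun N => ∑ n ∈ Finset.range N, (α n : ℝ)) atTop atTop)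
    {p : Y} {w x : ℕ → Y} (hw : ∀ n, w (n + 1) = W (f p) (T n (w n)) (σ (α n)))
    (hx : ∀ n, x (n + 1) = W (f (x n)) (T n (x n)) (σ (α n)))
    (hwp : Tendsto w atTop (𝓝 p)) : Tendsto x atTop (𝓝 p) := by
  have hκ : 0 < 1 - (κ : ℝ) := hf.one_sub_K_pos
  have hwp' := tendsto_iff_dist_tendsto_zero.1 hwp
  have hlim : Tendsto (fun n => dist (x n) (w n)) atTop (𝓝 0) := by
    refine tendsto_zero_of_le_one_sub_mul_add (γ := fun n => (1 - κ) * α n)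
      (b := fun n => κ * dist (w n) p / (1 - κ)) (fun n => dist_nonneg)
      (fun n => mul_le_one₀ (by linarith [κ.2]) (α n).2.1 (α n).2.2) ?_ ?_
      (fun n => mul_nonneg hκ.le (α n).2.1) fun n => ?_
    · simpa only [Finset.mul_sum] using hαsum.const_mul_atTop hκ
    · simpa using (hwp'.const_mul (κ : ℝ)).div_const (1 - (κ : ℝ))
    · have h := dist_W_W_le (f (x n)) (f p) (T n (x n)) (T n (w n)) (σ (α n))
      rw [← hx, ← hw, coe_symm_eq, sub_sub_cancel] at h
      have h1 : dist (T n (x n)) (T n (w n)) ≤ dist (x n) (w n) := by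
        simpa using (hT n).dist_le_mul (x n) (w n)
      have h2 : dist (f (x n)) (f p) ≤ κ * (dist (x n) (w n) + dist (w n) p) :=
        (hf.dist_le_mul _ _).trans (mul_le_mul_of_nonneg_left (dist_triangle _ _ _) κ.2)
      have h3 := mul_le_mul_of_nonneg_left h1 (sub_nonneg.2 (α n).2.2)
      have h4 := mul_le_mul_of_nonneg_left h2 (α n).2.1
      have h5 : (1 - κ : ℝ) * α n * (κ * dist (w n) p / (1 - κ)) = α n * (κ * dist (w n) p) := by
        field_simp
      rw [h5]
      linarith
  refine tendsto_iff_dist_tendsto_zero.2 ?_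
  refine squeeze_zero (fun n => dist_nonneg) (fun n => dist_triangle (x n) (w n) p) ?_
  simpa using hlim.add hwp'

end Browder

/-! ### Convex subsets as spaces -/

/-- A convex subset inherits the convexity mapping. -/
abbrev IsWConvex.toWSpace {X : Type*} [WSpace X] {C : Set X} (hC : IsWConvex C) : WSpace C where
  W x y t := ⟨WSpace.W (x : X) y t, hC.W_mem x x.2 y y.2 t⟩

theorem IsWConvex.toCAT0Space {X : Type*} [MetricSpace X] [WSpace X] [CAT0Space X] {C : Set X}
    (hC : IsWConvex C) : @CAT0Space C _ hC.toWSpace :=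
  letI := hC.toWSpace
  { dist_W_le := fun x y z t => WHyperbolicSpace.dist_W_le (x : X) y z t
    dist_W_W := fun x y s t => WHyperbolicSpace.dist_W_W (x : X) y s t
    W_symm := fun x y t => Subtype.ext (WHyperbolicSpace.W_symm (x : X) y t)
    dist_W_W_le := fun x y z w t => WHyperbolicSpace.dist_W_W_le (x : X) y z w t
    dist_midpoint_sq_le := fun x y z t ht => CAT0Space.dist_midpoint_sq_le (x : X) y z t ht }

theorem mainTheorem2 {X : Type*} [MetricSpace X] [WSpace X] [CAT0Space X] [CompleteSpace X]
    {C : Set X} (hC : IsWConvex C) (hCclosed : IsClosed C)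
    (T : ℕ → C → C) (hT : ∀ n, LipschitzWith 1 (T n))
    (hF : (⋂ n, Function.fixedPoints (T n)).Nonempty)
    (f : C → C) (κ : NNReal) (hf : ContractingWith κ f)
    (α : ℕ → unitInterval) (hα : ∀ n, 0 < (α n : ℝ))
    (lam : ℕ → ℝ) (hlam : ∀ n, 0 < lam n)
    (hRes : ∀ n m, ResolventLike T lam n m)
    (hαsum : Filter.Tendsto (fun N => ∑ n ∈ Finset.range N, (α n : ℝ)) Filter.atTop Filter.atTop)
    (hαlim : Filter.Tendsto (fun n => (α n : ℝ)) Filter.atTop (nhds 0))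
    (hαdiff : Filter.Tendsto (fun n => |(α (n + 1) : ℝ) - (α n : ℝ)| / (α n : ℝ) ^ 2)
      Filter.atTop (nhds 0))
    (lamLim : ℝ) (hlamLim : 0 < lamLim)
    (hlamTendsto : Filter.Tendsto lam Filter.atTop (nhds lamLim))
    (x₀ : C) :
    ∃ Q : C → C,
      (∀ x : C, Filter.Tendsto (abstractHPPA hC α T x x) Filter.atTop (nhds (Q x))) ∧
      ∃ p : C, Function.IsFixedPt (Q ∘ f) p ∧
        (∀ q : C, Function.IsFixedPt (Q ∘ f) q → q = p) ∧
        Filter.Tendsto (genVAM hC α f T x₀) Filter.atTop (nhds p) := by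
  let := hC.toWSpace
  have := hC.toCAT0Space
  have : CompleteSpace C := hCclosed.completeSpace_coe
  have : Nonempty C := hC.nonempty.to_subtype
  obtain ⟨c, hc⟩ := hF
  have hc' (n : ℕ) : T n c = c := Set.mem_iInter.1 hc n
  have hH (u x : C) (n : ℕ) : abstractHPPA hC α T u x (n + 1)
      = WSpace.W u (T n (abstractHPPA hC α T u x n)) (unitInterval.symm (α n)) := rfl
  have hlim (x : C) : ∃ q, Tendsto (abstractHPPA hC α T x x) atTop (𝓝 q) := by
    obtain ⟨q, hq⟩ := exists_tendsto_halpern hT hc' hlamLim hlamTendsto (fun n m => hRes n m) hα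
      hαsum hαlim hαdiff x
    exact ⟨q, hq _ (hH x x)⟩
  choose Q hQ using hlim
  have hQlip : LipschitzWith 1 Q := LipschitzWith.of_dist_le_mul fun x y => by
    rw [NNReal.coe_one, one_mul]
    exact le_of_tendsto' ((hQ x).dist (hQ y))
      (dist_halpern_le hT rfl rfl (hH x x) (hH y y))
  have hQf : ContractingWith κ (Q ∘ f) := ⟨hf.1, by simpa using hQlip.comp hf.2⟩
  have hp := hQf.fixedPoint_isFixedPt
  refine ⟨Q, hQ, ContractingWith.fixedPoint _ hQf, hp, fun q hq => hQf.fixedPoint_unique hq, ?_⟩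
  have hwp := hQ (f (ContractingWith.fixedPoint _ hQf))
  rw [show Q (f (ContractingWith.fixedPoint _ hQf)) = ContractingWith.fixedPoint _ hQf from hp]
    at hwp
  exact tendsto_viscosity hT hf hαsum (hH _ _) (fun n => rfl) hwp
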